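/- Consider a point-to-point system with $h\ge 1$ parallel unit-capacity edges $e_1,\dots,e_h$ from a source $s$ to a user $u$, and a collection $\mathcal A=\{I_1,\dots,I_d\}$ of arbitrary subsets of the edge set (the wiretap sets) such that every edge lies in at least one wiretap set. A code consists of a random message $M$ (arbitrary distribution on a finite set $\mathcal M$), an independent key $K$ uniform on a finite nonempty set $\mathcal K$, a finite transmission alphabet, and a map from $\mathcal M\times\mathcal K$ to this alphabet for each edge $e$, whose value $Y_e$ is transmitted on $e$. The code is admissible if for all $m\ne m'$ and all $k,k'$ the symbols received by $u$ from $(m,k)$ and from $(m',k')$ differ (decodability), and $H(M\mid Y_I)=H(M)$ for every $I\in\mathcal A$ (security). Let $A$ be the $h\times d$ incidence matrix of edges against wiretap sets and consider the covering program and its dual $$\min\{\mathbf 1^Tx: Ax\ge \mathbf 1,\ x\ge 0\},\qquad \max\{\mathbf 1^Ty: A^Ty\le \mathbf 1,\ y\ge 0\}.$$ 1. The dual program has a rational optimal basic feasible solution. Let $y^*\in\mathbb Q^h$ be any such solution. 2. The covering program attains its minimum, and its minimal value is $\mathbf 1^Ty^*$. 3. Every admissible code satisfies $H(M)\le(\mathbf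 1^Ty^*-1)\,H(K)$; that is, when $H(M)>0$, $H(K)/H(M)\ge 1/(\mathbf 1^Ty^*-1)$. 4. This bound is tight. Let $g$ be the least common multiple of the denominators of the entries of $y^*$ in lowest terms, $w_i=g\,y^*_i\in\mathbb N$, $w_{\max}=\max_i w_i$ and $w=\sum_i w_i-g$, where $w\ge 0$. For every finite field $F_q$ with $q\ge d$ there is an $F_q$-linear admissible code with $M$ uniform on $F_q^{w}$, $K$ uniform on $F_q^{g}$ and transmission alphabet $F_q^{w_{\max}}$, in which edge $e_i$ carries a vector of $F_q^{w_i}$ padded with zeros. For this code $H(M)=w\log q$ and $H(K)=g\log q>0$, hence $$\frac{H(M)}{H(K)}=\mathbf 1^Ty^*-1 .$$ -/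

import Mathlib

open scoped Matrix

namespace WiretapP2P

noncomputable section

/-! Shannon entropy (natural logarithm) of random variables on a finite probability space
`Ω` with point masses `P`. -/

open Classical in
/-- `Pr(X = s)`. -/
def law {Ω S : Type*} [Fintype Ω] (P : Ω → ℝ) (X : Ω → S) (s : S) : ℝ :=
  ∑ ω, if X ω = s then P ω else 0

/-- `H(X) = - ∑ₛ Pr(X = s) log Pr(X = s)`. -/
def entropy {Ω S : Type*} [Fintype Ω] [Fintype S] (P : Ω → ℝ) (X : Ω → S) : ℝ :=
  ∑ s, Real.negMulLog (law P X s)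

/-- `H(X | Y) = - ∑ₛₜ Pr(X = s, Y = t) log (Pr(X = s, Y = t) / Pr(Y = t))`. -/
def condEntropy {Ω S T : Type*} [Fintype Ω] [Fintype S] [Fintype T]
    (P : Ω → ℝ) (X : Ω → S) (Y : Ω → T) : ℝ :=
  -∑ s, ∑ t, law P (fun ω => (X ω, Y ω)) (s, t) *
    Real.log (law P (fun ω => (X ω, Y ω)) (s, t) / law P Y t)

/-- A code for the point-to-point system with `h` parallel edges from `s` to `u`: a distribution
of the message `M` on the finite message set `Msg`, and for every edge `e` an encoding mapping
`Msg × Key → Alph`. The key `K` is uniform on `Key` and independent of `M`. -/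
structure Code (h : ℕ) (Msg Key Alph : Type*) [Fintype Msg] where
  prior : Msg → ℝ
  prior_mem : prior ∈ stdSimplex ℝ Msg
  enc : Fin h → Msg × Key → Alph

namespace Code

variable {h : ℕ} {Msg Key Alph : Type*} [Fintype Msg]

/-- The joint distribution of `(M, K)`. -/
def joint [Fintype Key] (c : Code h Msg Key Alph) (x : Msg × Key) : ℝ :=
  c.prior x.1 * (Fintype.card Key : ℝ)⁻¹

/-- `H(M)`. -/
def entropyMsg [Fintype Key] (c : Code h Msg Key Alph) : ℝ :=
  entropy c.joint (fun x : Msg × Key => x.1)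

/-- `H(K)`. -/
def entropyKey [Fintype Key] (c : Code h Msg Key Alph) : ℝ :=
  entropy c.joint (fun x : Msg × Key => x.2)

/-- `Y_A = (Y_e : e ∈ A)`, the symbols transmitted on the edges in `A`. -/
def symbols (c : Code h Msg Key Alph) (A : Finset (Fin h)) (x : Msg × Key) : A → Alph :=
  fun e => c.enc e x

/-- Distinct messages are distinguishable at the user node, whatever the keys. -/
def Decodable (c : Code h Msg Key Alph) : Prop :=
  ∀ m m' : Msg, m ≠ m' → ∀ k k' : Key, (fun e => c.enc e (m, k)) ≠ (fun e => c.enc e (m', k'))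

/-- `H(M | Y_A) = H(M)` for every wiretap set `A`. -/
def Secure [Fintype Key] [Fintype Alph] (c : Code h Msg Key Alph)
    (𝒜 : Finset (Finset (Fin h))) : Prop :=
  ∀ A ∈ 𝒜, condEntropy c.joint (fun x : Msg × Key => x.1) (c.symbols A) = c.entropyMsg

/-- Admissible codes: decodable and secure. -/
def Admissible [Fintype Key] [Fintype Alph] (c : Code h Msg Key Alph)
    (𝒜 : Finset (Finset (Fin h))) : Prop :=
  c.Decodable ∧ c.Secure 𝒜

/-- The message is uniformly distributed. -/
def UniformMsg (c : Code h Msg Key Alph) : Prop :=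
  ∀ m, c.prior m = (Fintype.card Msg : ℝ)⁻¹

/-- All encoding mappings are `F`-linear in `(m, k)`. -/
def IsLinear (F : Type*) [Field F] [AddCommGroup Msg] [Module F Msg] [AddCommGroup Key]
    [Module F Key] [AddCommGroup Alph] [Module F Alph] (c : Code h Msg Key Alph) : Prop :=
  ∀ e, IsLinearMap F (c.enc e)

end Code

/-! The covering linear program of the wiretap sets and its dual. -/

/-- The edge / wiretap-set incidence matrix `A_J`, where `J` is the set of all `h` edges. -/
def incidence {h : ℕ} (𝒜 : Finset (Finset (Fin h))) : Matrix (Fin h) 𝒜 ℝ :=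
  Matrix.of fun e I => if e ∈ I.1 then 1 else 0

/-- Feasibility for the covering program: minimize `1ᵀx` subject to `A_J x ≥ 1`, `x ≥ 0`. -/
def CoveringFeasible {h : ℕ} (𝒜 : Finset (Finset (Fin h))) (x : 𝒜 → ℝ) : Prop :=
  1 ≤ incidence 𝒜 *ᵥ x ∧ 0 ≤ x

/-- Feasibility for the dual program: maximize `1ᵀy` subject to `A_Jᵀ y ≤ 1`, `y ≥ 0`. -/
def DualFeasible {h : ℕ} (𝒜 : Finset (Finset (Fin h))) (y : Fin h → ℝ) : Prop :=
  (incidence 𝒜)ᵀ *ᵥ y ≤ 1 ∧ 0 ≤ y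

/-- Optimal solutions of the dual program. -/
def DualOptimal {h : ℕ} (𝒜 : Finset (Finset (Fin h))) (y : Fin h → ℝ) : Prop :=
  DualFeasible 𝒜 y ∧ ∀ z, DualFeasible 𝒜 z → ∑ e, z e ≤ ∑ e, y e

/-- The coefficient vectors of the constraints of the dual program that are active at `y`. -/
def activeRows {h : ℕ} (𝒜 : Finset (Finset (Fin h))) (y : Fin h → ℝ) : Set (Fin h → ℝ) :=
  {a | (∃ I : 𝒜, ((incidence 𝒜)ᵀ *ᵥ y) I = 1 ∧ a = (incidence 𝒜)ᵀ I) ∨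
    (∃ e : Fin h, y e = 0 ∧ a = Pi.single e 1)}

/-- `y` is a basic solution of the dual program: among the constraints active at `y` there are
`h` linearly independent ones. -/
def DualBasic {h : ℕ} (𝒜 : Finset (Finset (Fin h))) (y : Fin h → ℝ) : Prop :=
  ∃ v : Fin h → Fin h → ℝ, LinearIndependent ℝ v ∧ ∀ j, v j ∈ activeRows 𝒜 y

/-- `y` is a rational vector that is an optimal basic (feasible) solution of the dual program. -/
def RationalOptimalBasic {h : ℕ} (𝒜 : Finset (Finset (Fin h))) (y : Fin h → ℚ) : Prop :=
  DualOptimal 𝒜 (fun e => (y e : ℝ)) ∧ DualBasic 𝒜 (fun e => (y e : ℝ))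

/-- `g`: the least common multiple of the denominators of `y` in lowest terms. -/
def denomLcm {h : ℕ} (y : Fin h → ℚ) : ℕ :=
  Finset.univ.lcm fun e => (y e).den

end

end WiretapP2P

/-! Converse: let U be the entropy of all transmitted symbols. Decodability and security give H(Y_I)
≤ U − H(M) for each wiretap set I, and U ≤ H(M) + H(K). Since H(Y_A) is monotone and submodular in
A, a fractional cover x of value v ≥ 1 yields U ≤ ∑ x_I H(Y_I) ≤ v (U − H(M)), that is, H(M) ≤ (v −
1)(U − H(M)) ≤ (v − 1) H(K) (`Code.entropyMsg_le`). Strong duality (`exists_coveringFeasible`)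
supplies a cover whose value is that of y.

Achievability: after scaling by g, dual feasibility says that no wiretap set sees more than g of the
∑ w_e coordinates. A key matrix with rows independent on every wiretap set (`exists_linearIndepOn`)
can imitate there any contribution of the message. Optimality forces one wiretap set to see exactly
g coordinates (`exists_tight`); hence the key map is injective and ∑ w_e − g message columns
complete it to an invertible map.

Existence of y: an extreme point of the optimal face is basic, and a basic solution solves an
invertible rational linear system. -/

namespace WiretapP2P

/-! ### Entropy on a finite probability space -/

section Entropy

variable {Ω S T R : Type*} [Fintype Ω]

theorem law_nonneg {P : Ω → ℝ} (hP : 0 ≤ P) (X : Ω → S) (s : S) : 0 ≤ law P X s :=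
  Finset.sum_nonneg fun ω _ => by split_ifs; exacts [hP ω, le_rfl]

theorem law_pos {P : Ω → ℝ} (hP : 0 ≤ P) (X : Ω → S) {ω : Ω} (hω : P ω ≠ 0) :
    0 < law P X (X ω) := by
  classical
  refine Finset.sum_pos' (fun ω _ => by split_ifs; exacts [hP ω, le_rfl]) ⟨ω, Finset.mem_univ _, ?_⟩
  rw [if_pos rfl]
  exact lt_of_le_of_ne (hP ω) hω.symm

theorem law_le_law {P : Ω → ℝ} (hP : 0 ≤ P) {X : Ω → S} {Y : Ω → T} {s : S} {t : T}
    (h : ∀ ω, X ω = s → Y ω = t) : law P X s ≤ law P Y t := by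
  classical
  refine Finset.sum_le_sum fun ω _ => ?_
  by_cases hs : X ω = s
  · rw [if_pos hs, if_pos (h ω hs)]
  · rw [if_neg hs]
    split_ifs
    exacts [hP ω, le_rfl]

theorem sum_law_mul [Fintype S] (P : Ω → ℝ) (X : Ω → S) (φ : S → ℝ) :
    ∑ s, law P X s * φ s = ∑ ω, P ω * φ (X ω) := by
  classical
  simp only [law, Finset.sum_mul]
  rw [Finset.sum_comm]
  simp [ite_mul]

theorem sum_law [Fintype S] (P : Ω → ℝ) (X : Ω → S) : ∑ s, law P X s = ∑ ω, P ω := by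
  simpa using sum_law_mul P X fun _ => 1

theorem law_comp [Fintype S] [DecidableEq R] (P : Ω → ℝ) (X : Ω → S) (f : S → R) (r : R) :
    law P (fun ω => f (X ω)) r = ∑ s, if f s = r then law P X s else 0 := by
  have := sum_law_mul P X fun s => if f s = r then 1 else 0
  simp only [mul_ite, mul_one, mul_zero] at this
  rw [this, law]
  exact Finset.sum_congr rfl fun ω _ => by congr

/-- Entropy as an expectation over `Ω`: entropies of variables with different ranges can then be
compared pointwise in `ω`. -/
theorem entropy_eq_neg_sum [Fintype S] (P : Ω → ℝ) (X : Ω → S) :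
    entropy P X = -∑ ω, P ω * Real.log (law P X (X ω)) := by
  rw [← sum_law_mul P X fun s => Real.log (law P X s), ← Finset.sum_neg_distrib]
  exact Finset.sum_congr rfl fun s _ => by rw [Real.negMulLog, neg_mul]

/-- Entropy is monotone under refinement. -/
theorem entropy_le_entropy [Fintype S] [Fintype T] {P : Ω → ℝ} (hP : 0 ≤ P) {X : Ω → S}
    {Y : Ω → T} (h : ∀ ω ω', X ω' = X ω → Y ω' = Y ω) : entropy P Y ≤ entropy P X := by
  rw [entropy_eq_neg_sum, entropy_eq_neg_sum, neg_le_neg_iff]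
  refine Finset.sum_le_sum fun ω _ => ?_
  by_cases hω : P ω = 0
  · simp [hω]
  · exact mul_le_mul_of_nonneg_left
      (Real.log_le_log (law_pos hP X hω) (law_le_law hP (h ω))) (hP ω)

theorem entropy_congr [Fintype S] [Fintype T] {P : Ω → ℝ} (hP : 0 ≤ P) {X : Ω → S}
    {Y : Ω → T} (h : ∀ ω ω', X ω' = X ω ↔ Y ω' = Y ω) : entropy P X = entropy P Y :=
  le_antisymm (entropy_le_entropy hP fun ω ω' => (h ω ω').2)
    (entropy_le_entropy hP fun ω ω' => (h ω ω').1)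

theorem condEntropy_eq_sub [Fintype S] [Fintype T] {P : Ω → ℝ} (hP : 0 ≤ P) (X : Ω → S)
    (Y : Ω → T) :
    condEntropy P X Y = entropy P (fun ω => (X ω, Y ω)) - entropy P Y := by
  rw [condEntropy, ← Fintype.sum_prod_type'
    (f := fun s t => law P (fun ω => (X ω, Y ω)) (s, t) *
      Real.log (law P (fun ω => (X ω, Y ω)) (s, t) / law P Y t))]
  rw [sum_law_mul P (fun ω => (X ω, Y ω))
    fun p => Real.log (law P (fun ω => (X ω, Y ω)) (p.1, p.2) / law P Y p.2),
    entropy_eq_neg_sum, entropy_eq_neg_sum, ← neg_add', ← sub_eq_add_neg,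
    ← Finset.sum_sub_distrib]
  congr 1
  refine Finset.sum_congr rfl fun ω _ => ?_
  by_cases hω : P ω = 0
  · simp [hω]
  · rw [Real.log_div (law_pos hP (fun ω => (X ω, Y ω)) hω).ne' (law_pos hP Y hω).ne', mul_sub]

/-- Submodularity of entropy, for a common function `f ∘ X = g ∘ Y` of `X` and `Y`. -/
theorem entropy_submodular [Fintype S] [Fintype T] [Fintype R] {P : Ω → ℝ} (hP : 0 ≤ P)
    (hP1 : ∑ ω, P ω = 1) (X : Ω → S) (Y : Ω → T) (f : S → R) (g : T → R)
    (hfg : ∀ ω, f (X ω) = g (Y ω)) :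
    entropy P (fun ω => (X ω, Y ω)) + entropy P (fun ω => f (X ω)) ≤
      entropy P X + entropy P Y := by
  classical
  set Z : Ω → R := fun ω => f (X ω) with hZ
  set W : Ω → S × T := fun ω => (X ω, Y ω) with hW
  -- The ratio p(x) p(y) / (p(x, y) p(z)) has expectation at most 1; with log t ≤ t − 1 this gives
  -- nonnegative conditional mutual information.
  have hbound : ∑ p : S × T, law P W p *
      (law P X p.1 * law P Y p.2 / (law P W p * law P Z (f p.1))) ≤ 1 := by
    calc _ ≤ ∑ p : S × T, law P X p.1 / law P Z (f p.1) *
          (if g p.2 = f p.1 then law P Y p.2 else 0) := by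
          refine Finset.sum_le_sum fun p _ => ?_
          have h0 : 0 ≤ law P X p.1 / law P Z (f p.1) :=
            div_nonneg (law_nonneg hP _ _) (law_nonneg hP _ _)
          by_cases hp : law P W p = 0
          · rw [hp, zero_mul]
            refine mul_nonneg h0 ?_
            split_ifs
            exacts [law_nonneg hP _ _, le_rfl]
          · obtain ⟨ω, -, hω⟩ := Finset.exists_ne_zero_of_sum_ne_zero hp
            have hWω : W ω = p := by
              by_contra h
              exact hω (if_neg h)
            rw [if_pos (by rw [← hWω]; exact (hfg ω).symm)]
            refine le_of_eq ?_
            field_simp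
      _ = ∑ s, law P X s / law P Z (f s) * law P Z (f s) := by
          rw [Fintype.sum_prod_type]
          refine Finset.sum_congr rfl fun s _ => ?_
          simp only
          rw [← Finset.mul_sum, ← law_comp P Y g (f s), hZ, funext hfg]
      _ ≤ ∑ s, law P X s := by
          refine Finset.sum_le_sum fun s _ => ?_
          by_cases hs : law P Z (f s) = 0
          · rw [hs, mul_zero]
            exact law_nonneg hP _ _
          · rw [div_mul_cancel₀ _ hs]
      _ = 1 := by rw [sum_law, hP1]
  rw [sum_law_mul P W fun p => law P X p.1 * law P Y p.2 / (law P W p * law P Z (f p.1))]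
    at hbound
  have hlog : ∑ ω, P ω * (Real.log (law P X (X ω)) + Real.log (law P Y (Y ω)) -
      Real.log (law P W (W ω)) - Real.log (law P Z (Z ω))) ≤
      ∑ ω, (P ω * (law P X (X ω) * law P Y (Y ω) / (law P W (W ω) * law P Z (Z ω))) - P ω) := by
    refine Finset.sum_le_sum fun ω _ => ?_
    by_cases hω : P ω = 0
    · simp [hω]
    · have h1 := law_pos hP X hω
      have h2 := law_pos hP Y hω
      have h3 := law_pos hP W hω
      have h4 := law_pos hP Z hω
      have := Real.log_le_sub_one_of_pos (div_pos (mul_pos h1 h2) (mul_pos h3 h4))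
      rw [Real.log_div (mul_pos h1 h2).ne' (mul_pos h3 h4).ne', Real.log_mul h1.ne' h2.ne',
        Real.log_mul h3.ne' h4.ne'] at this
      calc _ ≤ P ω * (law P X (X ω) * law P Y (Y ω) / (law P W (W ω) * law P Z (Z ω)) - 1) :=
            mul_le_mul_of_nonneg_left (by linarith) (hP ω)
        _ = _ := by ring
  rw [Finset.sum_sub_distrib, hP1] at hlog
  simp only [mul_add, mul_sub, Finset.sum_add_distrib, Finset.sum_sub_distrib] at hlog
  simp only [entropy_eq_neg_sum]
  linarith

theorem entropy_of_law_eq [Fintype S] {P : Ω → ℝ} (hP1 : ∑ ω, P ω = 1) {X : Ω → S} {a : ℝ}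
    (h : ∀ s, law P X s = a⁻¹) : entropy P X = Real.log a := by
  simp only [entropy_eq_neg_sum, h, ← Finset.sum_mul, hP1, Real.log_inv]
  ring

end Entropy

/-! ### Fractional covers and submodular functions -/

section Covering

variable {h : ℕ}

/-- Fractional subadditivity of monotone submodular set functions. -/
theorem le_sum_mul_of_submodular {f : Finset (Fin h) → ℝ} (hf0 : f ∅ = 0) (hmono : Monotone f)
    (hsub : ∀ A B, f (A ∪ B) + f (A ∩ B) ≤ f A + f B) {𝒜 : Finset (Finset (Fin h))}
    {x : 𝒜 → ℝ} (hx : CoveringFeasible 𝒜 x) (S : Finset (Fin h)) :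
    f S ≤ ∑ I, x I * f (I.1 ∩ S) := by
  induction S using Finset.induction_on with
  | empty => simp [hf0]
  | insert e S he ih =>
    -- The marginal gain of `e` over `S`. By submodularity, every `I` containing `e` gains at least
    -- `δ` when `e` is added to `I ∩ S`, and these `I` have total weight at least 1.
    set δ := f (insert e S) - f S with hδ
    have hδ0 : 0 ≤ δ := sub_nonneg.2 (hmono (Finset.subset_insert e S))
    have hcov : 1 ≤ ∑ I : 𝒜, (if e ∈ I.1 then 1 else 0) * x I := hx.1 e
    have key : ∀ I : 𝒜, x I * f (I.1 ∩ S) + ((if e ∈ I.1 then 1 else 0) * x I) * δ ≤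
        x I * f (I.1 ∩ insert e S) := by
      intro I
      have hxI := hx.2 I
      simp only [Pi.zero_apply] at hxI
      by_cases heI : e ∈ I.1
      · have h1 := hsub (I.1 ∩ insert e S) S
        have h2 : I.1 ∩ insert e S ∪ S = insert e S := by
          ext a; simp only [Finset.mem_union, Finset.mem_inter, Finset.mem_insert]
          constructor
          · tauto
          · rintro (rfl | h) <;> tauto
        have h3 : I.1 ∩ insert e S ∩ S = I.1 ∩ S := by
          ext a; simp only [Finset.mem_inter, Finset.mem_insert]; tauto
        rw [h2, h3] at h1
        rw [if_pos heI, one_mul, ← mul_add]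
        exact mul_le_mul_of_nonneg_left (by linarith) hxI
      · rw [if_neg heI, Finset.inter_insert_of_notMem heI]
        simp
    calc f (insert e S) = f S + 1 * δ := by rw [hδ]; ring
      _ ≤ ∑ I, x I * f (I.1 ∩ S) + (∑ I : 𝒜, (if e ∈ I.1 then 1 else 0) * x I) * δ :=
        add_le_add ih (mul_le_mul_of_nonneg_right hcov hδ0)
      _ = ∑ I : 𝒜, (x I * f (I.1 ∩ S) + ((if e ∈ I.1 then 1 else 0) * x I) * δ) := by
        rw [Finset.sum_add_distrib, Finset.sum_mul]
      _ ≤ _ := Finset.sum_le_sum fun I _ => key I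

theorem le_sum_mul_of_submodular_univ {f : Finset (Fin h) → ℝ} (hf0 : f ∅ = 0)
    (hmono : Monotone f) (hsub : ∀ A B, f (A ∪ B) + f (A ∩ B) ≤ f A + f B)
    {𝒜 : Finset (Finset (Fin h))} {x : 𝒜 → ℝ} (hx : CoveringFeasible 𝒜 x) :
    f Finset.univ ≤ ∑ I, x I * f I.1 := by
  simpa only [Finset.inter_univ] using le_sum_mul_of_submodular hf0 hmono hsub hx Finset.univ

end Covering

/-! ### The converse bound and a criterion for security -/

namespace Code

variable {h : ℕ} {Msg Key Alph : Type*} [Fintype Msg]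

theorem symbols_eq_iff {c : Code h Msg Key Alph} {A : Finset (Fin h)} {x x' : Msg × Key} :
    c.symbols A x' = c.symbols A x ↔ ∀ e ∈ A, c.enc e x' = c.enc e x := by
  simp [funext_iff, symbols]

variable [Fintype Key]

theorem joint_nonneg (c : Code h Msg Key Alph) : 0 ≤ c.joint := fun x =>
  mul_nonneg (c.prior_mem.1 x.1) (by positivity)

theorem sum_joint [Nonempty Key] (c : Code h Msg Key Alph) : ∑ x, c.joint x = 1 := by
  rw [Fintype.sum_prod_type]
  simp [joint, ← Finset.mul_sum, ← Finset.sum_mul, c.prior_mem.2]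

theorem law_fst [Nonempty Key] (c : Code h Msg Key Alph) (m : Msg) :
    law c.joint (fun x : Msg × Key => x.1) m = c.prior m := by
  classical
  rw [law, Fintype.sum_prod_type, Finset.sum_eq_single m]
  · simp [joint]
    field_simp
  · intro m' _ hm; simp [hm]
  · simp

theorem law_snd (c : Code h Msg Key Alph) (k : Key) :
    law c.joint (fun x : Msg × Key => x.2) k = (Fintype.card Key : ℝ)⁻¹ := by
  classical
  rw [law, Fintype.sum_prod_type]
  simp [joint, ← Finset.sum_mul, c.prior_mem.2]

theorem entropyKey_eq [Nonempty Key] (c : Code h Msg Key Alph) :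
    c.entropyKey = Real.log (Fintype.card Key) :=
  entropy_of_law_eq c.sum_joint c.law_snd

theorem entropyMsg_eq [Nonempty Key] {c : Code h Msg Key Alph} (hc : c.UniformMsg) :
    c.entropyMsg = Real.log (Fintype.card Msg) :=
  entropy_of_law_eq c.sum_joint fun m => by rw [law_fst, hc m]

theorem entropy_pair [Nonempty Key] (c : Code h Msg Key Alph) :
    entropy c.joint (fun x : Msg × Key => x) ≤ c.entropyMsg + c.entropyKey := by
  have := entropy_submodular c.joint_nonneg c.sum_joint (fun x => x.1) (fun x => x.2)
    (fun _ => ()) (fun _ => ()) fun _ => rfl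
  have h0 : entropy c.joint (fun _ : Msg × Key => ()) = 0 := by
    rw [entropy_of_law_eq (a := 1) c.sum_joint, Real.log_one]
    intro s
    simp [law, c.sum_joint]
  rw [h0, add_zero] at this
  exact this

variable [Fintype Alph]

theorem monotone_entropy_symbols (c : Code h Msg Key Alph) :
    Monotone fun A => entropy c.joint (c.symbols A) := fun A B hAB =>
  entropy_le_entropy c.joint_nonneg fun x x' => by
    rw [symbols_eq_iff, symbols_eq_iff]
    exact fun hx e he => hx e (hAB he)

theorem entropy_symbols_empty [Nonempty Key] (c : Code h Msg Key Alph) :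
    entropy c.joint (c.symbols ∅) = 0 := by
  rw [entropy_of_law_eq (a := 1) c.sum_joint, Real.log_one]
  intro s
  simp [law, c.sum_joint, Subsingleton.elim _ s]

theorem entropy_symbols_submodular [Nonempty Key] (c : Code h Msg Key Alph)
    (A B : Finset (Fin h)) :
    entropy c.joint (c.symbols (A ∪ B)) + entropy c.joint (c.symbols (A ∩ B)) ≤
      entropy c.joint (c.symbols A) + entropy c.joint (c.symbols B) := by
  have := entropy_submodular c.joint_nonneg c.sum_joint (c.symbols A) (c.symbols B)
    (fun y (e : (A ∩ B : Finset (Fin h))) => y ⟨e, Finset.mem_of_mem_inter_left e.2⟩)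
    (fun y e => y ⟨e, Finset.mem_of_mem_inter_right e.2⟩) fun _ => rfl
  rw [entropy_congr c.joint_nonneg (X := c.symbols (A ∪ B))
    (Y := fun x => (c.symbols A x, c.symbols B x))]
  · exact this
  · intro x x'
    simp only [Prod.mk.injEq, symbols_eq_iff, Finset.mem_union, or_imp, forall_and]

/-- A fractional cover by wiretap sets bounds the message entropy of admissible codes. -/
theorem entropyMsg_le [Nonempty Key] {c : Code h Msg Key Alph} {𝒜 : Finset (Finset (Fin h))}
    (hc : c.Admissible 𝒜) {x : 𝒜 → ℝ} (hx : CoveringFeasible 𝒜 x) (hx1 : 1 ≤ ∑ I, x I) :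
    c.entropyMsg ≤ (∑ I, x I - 1) * c.entropyKey := by
  have hP := c.joint_nonneg
  set U := entropy c.joint (c.symbols Finset.univ) with hU
  -- By decodability the message is a function of all the symbols.
  have hdec : entropy c.joint (fun x => (x.1, c.symbols Finset.univ x)) = U := by
    refine entropy_congr hP fun x x' => ?_
    simp only [Prod.mk.injEq, and_iff_right_iff_imp]
    intro hxx
    by_contra hne
    refine hc.1 x'.1 x.1 hne x'.2 x.2 (funext fun e => ?_)
    exact symbols_eq_iff.1 hxx e (Finset.mem_univ e)
  have hkey : U - c.entropyMsg ≤ c.entropyKey := by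
    have h1 : U ≤ entropy c.joint (fun x : Msg × Key => x) :=
      entropy_le_entropy hP fun x x' hxx => by rw [hxx]
    linarith [c.entropy_pair]
  -- Security reads H(Y_I) = H(M, Y_I) − H(M), and H(M, Y_I) is at most H(M, Y) = U.
  have hI : ∀ I : 𝒜, entropy c.joint (c.symbols I.1) ≤ U - c.entropyMsg := by
    intro I
    have h1 := hc.2 I.1 I.2
    rw [condEntropy_eq_sub hP] at h1
    have h2 : entropy c.joint (fun x => (x.1, c.symbols I.1 x)) ≤
        entropy c.joint (fun x => (x.1, c.symbols Finset.univ x)) := by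
      refine entropy_le_entropy hP fun x x' => ?_
      simp only [Prod.mk.injEq, symbols_eq_iff]
      exact fun hxx => ⟨hxx.1, fun e _ => hxx.2 e (Finset.mem_univ e)⟩
    linarith
  have hcov := le_sum_mul_of_submodular_univ (f := fun A => entropy c.joint (c.symbols A))
    c.entropy_symbols_empty c.monotone_entropy_symbols
    c.entropy_symbols_submodular hx
  have hle : U ≤ (∑ I, x I) * (U - c.entropyMsg) := by
    rw [Finset.sum_mul]
    exact hcov.trans (Finset.sum_le_sum fun I _ => mul_le_mul_of_nonneg_left (hI I) (hx.2 I))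
  calc c.entropyMsg ≤ (∑ I, x I - 1) * (U - c.entropyMsg) := by linarith
    _ ≤ _ := mul_le_mul_of_nonneg_left hkey (by linarith)

/-- A code is secure against `A` if changing the message amounts, for the symbols on `A`, to a
permutation of the keys. -/
theorem condEntropy_symbols_eq [Nonempty Key] (c : Code h Msg Key Alph) (A : Finset (Fin h))
    (m₀ : Msg) (σ : Msg → Equiv.Perm Key)
    (hσ : ∀ m k, c.symbols A (m, k) = c.symbols A (m₀, σ m k)) :
    condEntropy c.joint (fun x : Msg × Key => x.1) (c.symbols A) = c.entropyMsg := by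
  classical
  -- The law of the symbols on `A` given the message `m₀`; reindexing the keys by `σ m` shows that
  -- every message induces this same law.
  set ν : (A → Alph) → ℝ := fun y =>
    ∑ k, if c.symbols A (m₀, k) = y then (Fintype.card Key : ℝ)⁻¹ else 0 with hν
  have hfib : ∀ m y, (∑ k, if c.symbols A (m, k) = y then c.joint (m, k) else 0) =
      c.prior m * ν y := by
    intro m y
    simp only [hν]
    rw [← Equiv.sum_comp (σ m) fun k =>
      if c.symbols A (m₀, k) = y then (Fintype.card Key : ℝ)⁻¹ else 0, Finset.mul_sum]
    refine Finset.sum_congr rfl fun k _ => ?_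
    rw [← hσ, mul_ite, mul_zero]
    rfl
  have hpair : ∀ m y, law c.joint (fun x : Msg × Key => (x.1, c.symbols A x)) (m, y) =
      c.prior m * ν y := by
    intro m y
    rw [← hfib, law, Fintype.sum_prod_type, Finset.sum_eq_single m]
    · exact Finset.sum_congr rfl fun k _ => by simp
    · intro m' _ hm; simp [hm]
    · simp
  have hlaw : ∀ y, law c.joint (c.symbols A) y = ν y := by
    intro y
    have : law c.joint (c.symbols A) y = ∑ m, c.prior m * ν y := by
      rw [law, Fintype.sum_prod_type]
      refine Finset.sum_congr rfl fun m _ => ?_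
      rw [← hfib]
      exact Finset.sum_congr rfl fun k _ => by congr
    rw [this, ← Finset.sum_mul, c.prior_mem.2, one_mul]
  have hν1 : ∑ y, ν y = 1 := by
    simp only [← hlaw]
    rw [sum_law, c.sum_joint]
  rw [condEntropy, entropyMsg, entropy, ← Finset.sum_neg_distrib]
  refine Finset.sum_congr rfl fun m _ => ?_
  rw [c.law_fst, Real.negMulLog, neg_mul, neg_inj]
  calc _ = ∑ y, (c.prior m * Real.log (c.prior m)) * ν y := by
        refine Finset.sum_congr rfl fun y _ => ?_
        rw [hpair, hlaw]
        by_cases hy : ν y = 0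
        · simp [hy]
        · rw [mul_div_cancel_right₀ _ hy]
          ring
    _ = _ := by rw [← Finset.mul_sum, hν1, mul_one]

end Code

/-! ### Linear programming duality and basic solutions -/

section Duality

variable {h : ℕ} {𝒜 : Finset (Finset (Fin h))}

theorem incidence_transpose_mulVec (y : Fin h → ℝ) (I : 𝒜) :
    ((incidence 𝒜)ᵀ *ᵥ y) I = ∑ e ∈ I.1, y e := by
  simp [Matrix.mulVec, dotProduct, incidence]

theorem dualFeasible_iff {y : Fin h → ℝ} :
    DualFeasible 𝒜 y ↔ (∀ I : 𝒜, ∑ e ∈ I.1, y e ≤ 1) ∧ ∀ e, 0 ≤ y e := by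
  simp only [DualFeasible, Pi.le_def, incidence_transpose_mulVec, Pi.one_apply, Pi.zero_apply]

theorem dualFeasible_single (e : Fin h) : DualFeasible 𝒜 (Pi.single e 1) := by
  refine dualFeasible_iff.2 ⟨fun I => ?_, fun e' => ?_⟩
  · rw [Finset.sum_pi_single']
    split_ifs <;> norm_num
  · by_cases he : e' = e
    · subst he; simp
    · simp [he]

theorem isClosed_setOf_dualFeasible : IsClosed {y | DualFeasible 𝒜 y} := by
  simp only [dualFeasible_iff, Set.ofPred_and, Set.ofPred_forall]
  refine (isClosed_iInter fun I => ?_).inter (isClosed_iInter fun e => ?_)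
  · exact isClosed_le (by fun_prop) (by fun_prop)
  · exact isClosed_le (by fun_prop) (by fun_prop)

theorem isCompact_setOf_dualFeasible (hcov : ∀ e : Fin h, ∃ I ∈ 𝒜, e ∈ I) :
    IsCompact {y | DualFeasible 𝒜 y} := by
  refine (isCompact_Icc (a := (0 : Fin h → ℝ)) (b := 1)).of_isClosed_subset
    isClosed_setOf_dualFeasible fun y hy => ⟨hy.2, fun e => ?_⟩
  obtain ⟨I, hI, he⟩ := hcov e
  have hy' := dualFeasible_iff.1 hy
  exact (Finset.single_le_sum (fun i _ => hy'.2 i) he).trans (hy'.1 ⟨I, hI⟩)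

theorem one_le_sum_of_dualOptimal (hh : 0 < h) {y : Fin h → ℝ} (hy : DualOptimal 𝒜 y) :
    1 ≤ ∑ e, y e := by
  simpa using hy.2 _ (dualFeasible_single ⟨0, hh⟩)

/-- Weak duality. -/
theorem sum_le_sum_of_feasible {x : 𝒜 → ℝ} (hx : CoveringFeasible 𝒜 x) {y : Fin h → ℝ}
    (hy : DualFeasible 𝒜 y) : ∑ e, y e ≤ ∑ I, x I := by
  calc ∑ e, y e = y ⬝ᵥ 1 := by simp [dotProduct]
    _ ≤ y ⬝ᵥ (incidence 𝒜 *ᵥ x) := dotProduct_le_dotProduct_of_nonneg_left hx.1 hy.2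
    _ = x ⬝ᵥ ((incidence 𝒜)ᵀ *ᵥ y) := by
      rw [Matrix.dotProduct_mulVec, Matrix.mulVec_transpose, dotProduct_comm]
    _ ≤ x ⬝ᵥ 1 := dotProduct_le_dotProduct_of_nonneg_left hy.1 hx.2
    _ = ∑ I, x I := by simp [dotProduct]

open Pointwise in
/-- Strong duality. -/
theorem exists_coveringFeasible (hh : 0 < h) {y : Fin h → ℝ} (hy : DualOptimal 𝒜 y) :
    ∃ x, CoveringFeasible 𝒜 x ∧ ∑ I, x I = ∑ e, y e := by
  set v := ∑ e, y e with hv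
  have hv1 : 1 ≤ v := one_le_sum_of_dualOptimal hh hy
  -- A cover of value at most `v` exists iff the all-ones vector lies in `C`. Capping the value at
  -- `v` makes `X` compact, which is what makes `C` closed.
  set X : Set (𝒜 → ℝ) := {x | 0 ≤ x ∧ ∑ I, x I ≤ v} with hX
  have hXclosed : IsClosed X :=
    (isClosed_le continuous_const continuous_id).inter
      (isClosed_le (f := fun x : 𝒜 → ℝ => ∑ I, x I) (by fun_prop) continuous_const)
  have hXcompact : IsCompact X :=
    (isCompact_Icc (a := (0 : 𝒜 → ℝ)) (b := fun _ => v)).of_isClosed_subset hXclosed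
      fun x hx => ⟨hx.1, fun I =>
        (Finset.single_le_sum (fun J _ => hx.1 J) (Finset.mem_univ I)).trans hx.2⟩
  have hXconvex : Convex ℝ X := by
    refine (convex_Ici 0).inter ?_
    exact convex_halfSpace_le (f := fun x : 𝒜 → ℝ => ∑ I, x I)
      ⟨fun a b => by simp [Finset.sum_add_distrib], fun a b => by simp [Finset.mul_sum]⟩ v
  set C : Set (Fin h → ℝ) := (incidence 𝒜).mulVecLin '' X +
    Set.Iic (0 : Fin h → ℝ) with hC
  have hCconvex : Convex ℝ C := (hXconvex.linear_image _).add (convex_Iic 0)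
  have hCclosed : IsClosed C :=
    isClosed_Iic.add_left_of_isCompact
      (hXcompact.image (LinearMap.continuous_of_finiteDimensional _))
  by_cases h1 : (1 : Fin h → ℝ) ∈ C
  · obtain ⟨_, ⟨x, hx, rfl⟩, z, hz, hxz⟩ := h1
    have hfeas : CoveringFeasible 𝒜 x := by
      refine ⟨?_, hx.1⟩
      rw [← hxz]
      simpa using hz
    exact ⟨x, hfeas, le_antisymm hx.2 (sum_le_sum_of_feasible hfeas hy.1)⟩
  · exfalso
    obtain ⟨f, u, hfu, huf⟩ := geometric_hahn_banach_closed_point hCconvex hCclosed h1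
    have hf : ∀ z, f z = ∑ e, z e * f (Pi.single e 1) := fun z => by
      conv_lhs => rw [pi_eq_sum_univ' z, map_sum]
      refine Finset.sum_congr rfl fun e _ => ?_
      rw [map_smul, smul_eq_mul]
    set c : Fin h → ℝ := fun e => f (Pi.single e 1) with hc
    have h0X : (0 : 𝒜 → ℝ) ∈ X := ⟨le_rfl, by simp; linarith⟩
    have hIic : ∀ z ≤ 0, z ∈ C := fun z hz =>
      ⟨0, ⟨0, h0X, by simp⟩, z, hz, by simp⟩
    have hu : 0 < u := by simpa using hfu 0 (hIic 0 le_rfl)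
    have hc0 : ∀ e, 0 ≤ c e := by
      intro e
      by_contra! hce
      -- If `c e < 0`, this vector is nonpositive, yet `f` takes the value `u` on it.
      have hmem : (u / c e) • (Pi.single e 1 : Fin h → ℝ) ∈ C := by
        refine hIic _ fun e' => ?_
        by_cases he : e' = e
        · subst he
          simpa using (div_neg_of_pos_of_neg hu hce).le
        · simp [he]
      have := hfu _ hmem
      rw [map_smul, smul_eq_mul, div_mul_cancel₀ _ hce.ne] at this
      exact lt_irrefl _ this
    have hI : ∀ I : 𝒜, v * ∑ e ∈ I.1, c e < u := by
      intro I
      have hmem : (incidence 𝒜).mulVecLin (Pi.single I v) ∈ C := by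
        refine ⟨_, ⟨Pi.single I v, ⟨fun J => ?_, by simp⟩, rfl⟩, 0, by simp, by simp⟩
        by_cases hJ : J = I
        · subst hJ; simp; linarith
        · simp [hJ]
      have := hfu _ hmem
      rw [hf] at this
      simpa [incidence, Finset.mul_sum, Finset.sum_ite_mem] using this
    -- Rescaling the separating functional gives a dual point of value `v * f 1 / u`, which exceeds
    -- `v` because `f 1 > u`.
    have hfeas : DualFeasible 𝒜 fun e => v / u * c e := by
      refine dualFeasible_iff.2 ⟨fun I => ?_, fun e => mul_nonneg (by positivity) (hc0 e)⟩
      rw [← Finset.mul_sum, div_mul_eq_mul_div, div_le_one hu]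
      exact (hI I).le
    have hlt := hy.2 _ hfeas
    rw [hf] at huf
    simp only [Pi.one_apply, one_mul] at huf
    rw [← Finset.mul_sum, ← hv, div_mul_eq_mul_div, div_le_iff₀ hu] at hlt
    nlinarith

theorem isLeast_covering (hh : 0 < h) {y : Fin h → ℝ} (hy : DualOptimal 𝒜 y) :
    IsLeast {v : ℝ | ∃ x : 𝒜 → ℝ, CoveringFeasible 𝒜 x ∧ v = ∑ I, x I} (∑ e, y e) := by
  refine ⟨?_, ?_⟩
  · obtain ⟨x, hx, hxy⟩ := exists_coveringFeasible hh hy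
    exact ⟨x, hx, hxy.symm⟩
  · rintro _ ⟨x, hx, rfl⟩
    exact sum_le_sum_of_feasible hx hy.1

/-- Along a direction orthogonal to all active constraints, feasibility persists for a while. -/
theorem eventually_dualFeasible {y z : Fin h → ℝ} (hy : DualFeasible 𝒜 y)
    (hz : ∀ a ∈ activeRows 𝒜 y, a ⬝ᵥ z = 0) :
    ∀ᶠ t in nhds (0 : ℝ), DualFeasible 𝒜 (y + t • z) := by
  have hy' := dualFeasible_iff.1 hy
  simp only [dualFeasible_iff, Filter.eventually_and, Filter.eventually_all]
  refine ⟨fun I => ?_, fun e => ?_⟩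
  -- Slack constraints survive by continuity; active ones are constant along `z`.
  · rcases (hy'.1 I).lt_or_eq with hlt | heq
    · have hcont : Continuous fun t : ℝ => ∑ e ∈ I.1, (y + t • z) e := by
        simp only [Pi.add_apply, Pi.smul_apply]
        fun_prop
      exact (hcont.continuousAt.eventually_lt continuousAt_const (by simpa using hlt)).mono
        fun t ht => ht.le
    · have h0 := hz _ (Or.inl ⟨I, by rw [incidence_transpose_mulVec, heq], rfl⟩)
      have h1 : ∑ e ∈ I.1, z e = 0 := by
        rw [← incidence_transpose_mulVec]; exact h0
      refine Filter.Eventually.of_forall fun t => ?_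
      simp [Finset.sum_add_distrib, ← Finset.mul_sum, h1, heq]
  · rcases (hy'.2 e).lt_or_eq with hlt | heq
    · have hcont : Continuous fun t : ℝ => (y + t • z) e := by
        simp only [Pi.add_apply, Pi.smul_apply]
        fun_prop
      exact (continuousAt_const.eventually_lt hcont.continuousAt (by simpa using hlt)).mono
        fun t ht => ht.le
    · have h0 := hz _ (Or.inr ⟨e, heq.symm, rfl⟩)
      rw [single_one_dotProduct] at h0
      refine Filter.Eventually.of_forall fun t => ?_
      simp [h0, ← heq]

theorem dualBasic_of_span_eq_top {y : Fin h → ℝ}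
    (hspan : Submodule.span ℝ (activeRows 𝒜 y) = ⊤) : DualBasic 𝒜 y := by
  obtain ⟨b, hb, hbspan, hli⟩ := exists_linearIndependent ℝ (activeRows 𝒜 y)
  let B : Module.Basis b ℝ (Fin h → ℝ) := Module.Basis.mk hli (by simp [hbspan, hspan])
  let σ : Fin h ≃ b := (Pi.basisFun ℝ (Fin h)).indexEquiv B
  exact ⟨fun j => (σ j).1, hli.comp σ σ.injective, fun j => hb (σ j).2⟩

/-- An extreme point of the compact set of optimal solutions is basic: otherwise some nonzero `z` is
orthogonal to all active rows, and `y` is the midpoint of two optimal points `y ± (ε / 2) • z`. -/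
theorem exists_dualOptimal_dualBasic (hcov : ∀ e : Fin h, ∃ I ∈ 𝒜, e ∈ I) :
    ∃ y, DualOptimal 𝒜 y ∧ DualBasic 𝒜 y := by
  have hcomp := isCompact_setOf_dualFeasible hcov
  have hcont : Continuous fun y : Fin h → ℝ => ∑ e, y e := by fun_prop
  obtain ⟨y₀, hy₀, hmax⟩ := hcomp.exists_isMaxOn ⟨0, dualFeasible_iff.2 (by simp)⟩
    hcont.continuousOn
  set O : Set (Fin h → ℝ) := {y | DualFeasible 𝒜 y} ∩ {y | ∑ e, y e = ∑ e, y₀ e} with hO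
  have hOc : IsCompact O := hcomp.inter_right (isClosed_eq hcont continuous_const)
  obtain ⟨y, hyO, hext⟩ := hOc.extremePoints_nonempty ⟨y₀, hy₀, rfl⟩
  have hopt : DualOptimal 𝒜 y := ⟨hyO.1, fun z hz => (hmax hz).trans hyO.2.ge⟩
  refine ⟨y, hopt, dualBasic_of_span_eq_top ?_⟩
  by_contra hne
  obtain ⟨f, hf0, hfker⟩ := Submodule.exists_le_ker_of_lt_top _ (lt_top_iff_ne_top.2 hne)
  set z : Fin h → ℝ := fun e => f (Pi.single e 1) with hz
  have hfz : ∀ a, a ⬝ᵥ z = f a := fun a => by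
    rw [LinearMap.pi_apply_eq_sum_univ f a]
    refine Finset.sum_congr rfl fun e _ => ?_
    refine congrArg (a e * f ·) (funext fun j => ?_)
    simp [Pi.single_apply, eq_comm]
  have hz0 : z ≠ 0 := fun h0 => hf0 (LinearMap.ext fun a => by rw [← hfz, h0]; simp)
  obtain ⟨ε, hε, hball⟩ := Metric.eventually_nhds_iff.1 (eventually_dualFeasible hyO.1
    (z := z) fun a ha => by rw [hfz]; exact hfker (Submodule.subset_span ha))
  have hp : DualFeasible 𝒜 (y + (ε / 2) • z) := hball (by
    rw [Real.dist_eq, sub_zero, abs_of_pos (by positivity)]; linarith)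
  have hm : DualFeasible 𝒜 (y + (-(ε / 2)) • z) := hball (by
    rw [Real.dist_eq, sub_zero, abs_neg, abs_of_pos (by positivity)]; linarith)
  have hsum : ∀ t : ℝ, ∑ e, (y + t • z) e = ∑ e, y e + t * ∑ e, z e := fun t => by
    simp [Finset.sum_add_distrib, Finset.mul_sum]
  have h1 := hopt.2 _ hp
  have h2 := hopt.2 _ hm
  rw [hsum] at h1 h2
  -- Neither direction may improve the objective, so it is constant along `z`.
  have hz1 : ∑ e, z e = 0 := by
    have : 0 < ε / 2 := by positivity
    apply le_antisymm <;> nlinarith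
  have hmem : ∀ t : ℝ, DualFeasible 𝒜 (y + t • z) → y + t • z ∈ O := fun t ht =>
    ⟨ht, by
      change ∑ e, (y + t • z) e = _
      rw [hsum, hz1, mul_zero, add_zero]; exact hyO.2⟩
  have hseg : y ∈ openSegment ℝ (y + (ε / 2) • z) (y + (-(ε / 2)) • z) :=
    ⟨1 / 2, 1 / 2, by norm_num, by norm_num, by norm_num, by module⟩
  have := hext (hmem _ hp) (hmem _ hm) hseg
  rw [add_eq_left, smul_eq_zero] at this
  exact this.elim (by positivity) hz0

/-- Basic solutions are rational. -/
theorem exists_rat_of_dualBasic {y : Fin h → ℝ} (hy : DualBasic 𝒜 y) :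
    ∃ r : Fin h → ℚ, (fun e => (r e : ℝ)) = y := by
  obtain ⟨v, hv, hact⟩ := hy
  have hrat : ∀ j, ∃ (a : Fin h → ℚ) (b : ℚ), (∀ e, v j e = a e) ∧ v j ⬝ᵥ y = b := by
    intro j
    rcases hact j with ⟨I, hI, hvj⟩ | ⟨e, he, hvj⟩
    · refine ⟨fun e => if e ∈ I.1 then 1 else 0, 1, fun e => ?_, ?_⟩
      · rw [hvj]; simp [incidence, apply_ite]
      · rw [hvj, Rat.cast_one, ← hI]; rfl
    · refine ⟨Pi.single e 1, 0, fun e' => ?_, ?_⟩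
      · rw [hvj]
        by_cases h' : e' = e
        · subst h'; simp
        · simp [h']
      · rw [hvj, single_one_dotProduct, he, Rat.cast_zero]
  choose a b ha hb using hrat
  -- `y` solves the system of its `h` independent active constraints, whose coefficients are
  -- rational; invertibility over `ℝ` descends to `ℚ` through the determinant.
  set M : Matrix (Fin h) (Fin h) ℚ := Matrix.of a with hM
  have hMv : M.map (Rat.castHom ℝ) = Matrix.of v := by
    ext i j
    simp [hM, ha]
  have hunitR : IsUnit (Matrix.of v) := Matrix.linearIndependent_rows_iff_isUnit.1 hv
  have hunit : IsUnit M.det := by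
    have h1 := (Matrix.isUnit_iff_isUnit_det _).1 hunitR
    rw [← hMv, ← RingHom.mapMatrix_apply, ← RingHom.map_det, isUnit_iff_ne_zero] at h1
    exact isUnit_iff_ne_zero.2 fun h0 => h1 (by rw [h0, map_zero])
  refine ⟨M⁻¹ *ᵥ b, Matrix.mulVec_injective_of_isUnit hunitR ?_⟩
  have h1 : M *ᵥ (M⁻¹ *ᵥ b) = b := by
    rw [Matrix.mulVec_mulVec, Matrix.mul_nonsing_inv _ hunit, Matrix.one_mulVec]
  ext i
  have h2 := congrArg (Rat.castHom ℝ) (congrFun h1 i)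
  rw [RingHom.map_mulVec, hMv] at h2
  exact h2.trans (hb i).symm

theorem exists_rationalOptimalBasic (hcov : ∀ e : Fin h, ∃ I ∈ 𝒜, e ∈ I) :
    ∃ y : Fin h → ℚ, RationalOptimalBasic 𝒜 y := by
  obtain ⟨y, hopt, hbasic⟩ := exists_dualOptimal_dualBasic hcov
  obtain ⟨r, rfl⟩ := exists_rat_of_dualBasic hbasic
  exact ⟨r, hopt, hbasic⟩

/-- Some wiretap set is tight for an optimal solution of the dual program. -/
theorem exists_tight (hh : 0 < h) {y : Fin h → ℝ} (hy : DualOptimal 𝒜 y) :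
    ∃ I : 𝒜, ∑ e ∈ I.1, y e = 1 := by
  by_contra! hne
  set e₀ : Fin h := ⟨0, hh⟩
  have hy' := dualFeasible_iff.1 hy.1
  -- With every wiretap constraint slack, the coordinate `e₀` could be increased, against
  -- optimality.
  have hev : ∀ᶠ t in nhdsWithin (0 : ℝ) (Set.Ioi 0),
      DualFeasible 𝒜 (y + t • Pi.single e₀ 1) := by
    simp only [dualFeasible_iff, Filter.eventually_and, Filter.eventually_all]
    refine ⟨fun I => ?_, fun e => ?_⟩
    · have hcont : Continuous fun t : ℝ =>
          ∑ e ∈ I.1, (y + t • (Pi.single e₀ 1 : Fin h → ℝ)) e := by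
        simp only [Pi.add_apply, Pi.smul_apply]
        fun_prop
      exact ((hcont.continuousAt.eventually_lt continuousAt_const
        (by simpa using lt_of_le_of_ne (hy'.1 I) (hne I))).mono
          fun t ht => ht.le).filter_mono nhdsWithin_le_nhds
    · filter_upwards [self_mem_nhdsWithin] with t ht
      exact add_nonneg (hy'.2 e) (mul_nonneg (le_of_lt ht)
        ((dualFeasible_iff.1 (dualFeasible_single (𝒜 := 𝒜) e₀)).2 e))
  obtain ⟨t, ht, ht0⟩ := (hev.and self_mem_nhdsWithin).exists
  have := hy.2 _ ht
  simp only [Pi.add_apply, Pi.smul_apply, Finset.sum_add_distrib, smul_eq_mul,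
    ← Finset.mul_sum, Finset.sum_pi_single', Finset.mem_univ, if_true] at this
  have ht0' : 0 < t := ht0
  linarith

end Duality

/-! ### Construction of the linear code -/

section LinearCode

variable {F : Type*} [Field F]

theorem surjective_of_linearIndependent {ι : Type*} [Fintype ι] {g : ℕ} {v : ι → Fin g → F}
    (hv : LinearIndependent F v) : Function.Surjective (Matrix.of v).mulVecLin := by
  have h1 : (Matrix.of v).rank = Fintype.card ι := LinearIndependent.rank_matrix hv
  rw [← LinearMap.range_eq_top]
  refine Submodule.eq_top_of_finrank_eq ?_
  rw [Module.finrank_fintype_fun_eq_card]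
  exact h1

/-- An injective linear map extends to an injective linear map on any larger dimension that
fits into the target. -/
theorem exists_injective_add {K V : Type*} [AddCommGroup K] [Module F K] [AddCommGroup V]
    [Module F V] [FiniteDimensional F V] (L : K →ₗ[F] V) (hL : Function.Injective L) {n : ℕ}
    (hn : n + Module.finrank F K = Module.finrank F V) :
    ∃ B : (Fin n → F) →ₗ[F] V, Function.Injective (B.coprod L) := by
  obtain ⟨C, hC⟩ := Submodule.exists_isCompl (LinearMap.range L)
  have hrank := Submodule.finrank_add_eq_of_isCompl hC
  rw [LinearMap.finrank_range_of_inj hL] at hrank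
  have e : (Fin n → F) ≃ₗ[F] C := LinearEquiv.ofFinrankEq _ _ (by
    rw [Module.finrank_fin_fun]; omega)
  have he : Function.Injective (C.subtype ∘ₗ e.toLinearMap) :=
    fun a b hab => e.injective (Subtype.ext hab)
  refine ⟨C.subtype ∘ₗ e.toLinearMap, ?_⟩
  rw [← LinearMap.ker_eq_bot, LinearMap.ker_coprod_of_disjoint_range]
  · rw [LinearMap.ker_eq_bot.2 hL, LinearMap.ker_eq_bot.2 he, Submodule.prod_bot]
  · refine hC.disjoint.symm.mono_left ?_
    rintro _ ⟨x, rfl⟩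
    exact (e x).2

variable [Fintype F]

/-- A vector space over `F_q` is not the union of at most `q` proper subspaces. -/
theorem exists_forall_notMem_of_card_le {V κ : Type*} [AddCommGroup V] [Module F V]
    [Finite V] [Fintype κ] (hκ : Fintype.card κ ≤ Fintype.card F) (W : κ → Submodule F V)
    (hW : ∀ k, W k ≠ ⊤) : ∃ v, ∀ k, v ∉ W k := by
  classical
  have := Fintype.ofFinite V
  rcases isEmpty_or_nonempty κ with hκ0 | ⟨⟨k₀⟩⟩
  · exact ⟨0, fun k => (hκ0.false k).elim⟩
  by_contra! hcov
  set q := Fintype.card F with hq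
  have hq1 : 1 < q := Fintype.one_lt_card
  set N := Fintype.card V with hN
  have hcard : ∀ k, Fintype.card (W k) * q ≤ N := by
    intro k
    rw [hN, Module.card_eq_pow_finrank (K := F) (V := V),
      Module.card_eq_pow_finrank (K := F) (V := W k), ← pow_succ]
    exact Nat.pow_le_pow_right hq1.le (Submodule.finrank_lt (hW k))
  -- Counting nonzero vectors is what allows as many as `q` subspaces: a cover would give q (N − 1)
  -- ≤ q (N − q), impossible for 1 < q ≤ N.
  have hsub : (Finset.univ : Finset V).erase 0 ⊆
      Finset.univ.biUnion fun k => (Finset.univ.filter (· ∈ W k)).erase 0 := by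
    intro v hv
    obtain ⟨k, hk⟩ := hcov v
    simp only [Finset.mem_erase, Finset.mem_univ, and_true] at hv
    simp only [Finset.mem_biUnion, Finset.mem_univ, true_and, Finset.mem_erase,
      Finset.mem_filter]
    exact ⟨k, hv, hk⟩
  have hc := (Finset.card_le_card hsub).trans Finset.card_biUnion_le
  rw [Finset.card_erase_of_mem (Finset.mem_univ _), Finset.card_univ, ← hN] at hc
  have hk : ∀ k, ((Finset.univ.filter (· ∈ W k)).erase 0).card = Fintype.card (W k) - 1 := by
    intro k
    rw [Finset.card_erase_of_mem (by simp), Fintype.card_subtype]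
  simp only [hk] at hc
  have hmul : q * (N - 1) ≤ Fintype.card κ * (N - q) := by
    calc q * (N - 1) ≤ q * ∑ k, (Fintype.card (W k) - 1) := Nat.mul_le_mul_left _ hc
      _ = ∑ k, (Fintype.card (W k) * q - q) := by
        rw [Finset.mul_sum]
        exact Finset.sum_congr rfl fun k _ => by rw [Nat.mul_sub, mul_comm, mul_one]
      _ ≤ ∑ _k : κ, (N - q) := Finset.sum_le_sum fun k _ => Nat.sub_le_sub_right (hcard k) q
      _ = _ := by simp
  have hNq : q ≤ N := le_trans (Nat.le_mul_of_pos_left q Fintype.card_pos) (hcard k₀)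
  have h1 : q * (N - 1) ≤ q * (N - q) := hmul.trans (Nat.mul_le_mul_right _ hκ)
  have h2 := Nat.le_of_mul_le_mul_left h1 (by omega)
  omega

/-- Over `F_q` there are vectors in `F_q^g` which are linearly independent on each of at most `q`
given index sets of size at most `g`. -/
theorem exists_linearIndepOn {ι κ : Type*} [Fintype ι] [Fintype κ]
    (hκ : Fintype.card κ ≤ Fintype.card F) {g : ℕ} (S : κ → Finset ι)
    (hS : ∀ k, (S k).card ≤ g) :
    ∃ v : ι → Fin g → F, ∀ k, LinearIndepOn F v (S k : Set ι) := by
  classical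
  suffices H : ∀ T : Finset ι, ∃ v : ι → Fin g → F,
      ∀ k, LinearIndepOn F v ((S k ∩ T : Finset ι) : Set ι) by
    obtain ⟨v, hv⟩ := H Finset.univ
    exact ⟨v, fun k => by simpa using hv k⟩
  intro T
  induction T using Finset.induction_on with
  | empty => exact ⟨0, fun k => by simp⟩
  | insert a T ha ih =>
    obtain ⟨v, hv⟩ := ih
    -- Greedy choice of the vector at `a`: it must avoid, for each `S k` containing `a`, the span of
    -- the vectors already chosen there. That span is generated by fewer than `g` vectors, hence
    -- proper.
    obtain ⟨u, hu⟩ := exists_forall_notMem_of_card_le (F := F) (V := Fin g → F)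
      (κ := {k : κ // a ∈ S k})
      ((Fintype.card_subtype_le _).trans hκ)
      (fun k => Submodule.span F (((S k.1 ∩ T).image v : Finset (Fin g → F)) : Set (Fin g → F)))
      (by
        intro k htop
        have h1 := finrank_span_finset_le_card (R := F) ((S k.1 ∩ T).image v)
        rw [Set.finrank, htop, finrank_top, Module.finrank_fin_fun] at h1
        have h2 : (S k.1 ∩ T).card < (S k.1).card := Finset.card_lt_card
          ⟨Finset.inter_subset_left, fun h =>
            ha (Finset.mem_of_mem_inter_right (h k.2))⟩
        have h3 := hS k.1
        have h4 : ((S k.1 ∩ T).image v).card ≤ (S k.1 ∩ T).card := Finset.card_image_le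
        omega)
    refine ⟨Function.update v a u, fun k => ?_⟩
    have heq : Set.EqOn v (Function.update v a u) ((S k ∩ T : Finset ι) : Set ι) := by
      intro i hi
      rw [Function.update_of_ne]
      rintro rfl
      exact ha (Finset.mem_of_mem_inter_right hi)
    by_cases hk : a ∈ S k
    · rw [Finset.inter_insert_of_mem hk, Finset.coe_insert]
      refine ((linearIndepOn_congr heq).1 (hv k)).insert ?_
      rw [← heq.image_eq, Function.update_self, ← Finset.coe_image]
      exact hu ⟨k, hk⟩
    · rw [Finset.inter_insert_of_notMem hk]
      exact (linearIndepOn_congr heq).1 (hv k)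

/-- A linear code whose edge `e` carries the coordinates `⟨e, j⟩`, `j < w e`, of a vector. -/
noncomputable def blockCode {h : ℕ} {n g : ℕ} (w : Fin h → ℕ)
    (T : (Fin n → F) × (Fin g → F) →ₗ[F] ((e : Fin h) × Fin (w e) → F)) :
    Code h (Fin n → F) (Fin g → F) (Fin (Finset.univ.sup w) → F) where
  prior _ := (Fintype.card (Fin n → F) : ℝ)⁻¹
  prior_mem := by
    refine ⟨fun _ => by positivity, ?_⟩
    rw [Finset.sum_const, Finset.card_univ, nsmul_eq_mul]
    exact mul_inv_cancel₀ (by exact_mod_cast Fintype.card_ne_zero)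
  enc e x j := if hj : (j : ℕ) < w e then T x ⟨e, j, hj⟩ else 0

section BlockCode

variable {h n g : ℕ} {w : Fin h → ℕ}
  {T : (Fin n → F) × (Fin g → F) →ₗ[F] ((e : Fin h) × Fin (w e) → F)}

theorem blockCode_enc_eq_iff {e : Fin h} {x x' : (Fin n → F) × (Fin g → F)} :
    (blockCode w T).enc e x = (blockCode w T).enc e x' ↔ ∀ j, T x ⟨e, j⟩ = T x' ⟨e, j⟩ := by
  refine ⟨fun hx j => ?_, fun hx => funext fun j => ?_⟩
  · have hj : (j : ℕ) < Finset.univ.sup w :=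
      j.2.trans_le (Finset.le_sup (f := w) (Finset.mem_univ e))
    simpa [blockCode] using congrFun hx ⟨j, hj⟩
  · simp only [blockCode]
    split_ifs with hj
    exacts [hx ⟨j, hj⟩, rfl]

theorem isLinear_blockCode : (blockCode w T).IsLinear F := fun e =>
  { map_add := fun x y => by
      ext j
      simp only [blockCode, Pi.add_apply]
      split_ifs <;> simp
    map_smul := fun a x => by
      ext j
      simp only [blockCode, Pi.smul_apply]
      split_ifs <;> simp }

theorem decodable_blockCode (hT : Function.Injective T) : (blockCode w T).Decodable := by
  intro m m' hm k k' heq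
  have : T (m, k) = T (m', k') := by
    ext ⟨e, j⟩
    exact blockCode_enc_eq_iff.1 (congrFun heq e) j
  exact hm (congrArg Prod.fst (hT this))

/-- If some key reproduces on `A` the contribution of each message, then by linearity a change of
message acts there as a translation of the key. -/
theorem condEntropy_blockCode (A : Finset (Fin h))
    (hA : ∀ m, ∃ k, ∀ e ∈ A, ∀ j, T (0, k) ⟨e, j⟩ = T (m, 0) ⟨e, j⟩) :
    condEntropy (blockCode w T).joint (fun x => x.1) ((blockCode w T).symbols A) =
      (blockCode w T).entropyMsg := by
  choose k₀ hk₀ using hA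
  refine Code.condEntropy_symbols_eq _ A 0 (fun m => Equiv.addRight (k₀ m)) fun m k => ?_
  rw [Code.symbols_eq_iff]
  intro e he
  rw [blockCode_enc_eq_iff]
  intro j
  have h1 : ((m, k) : (Fin n → F) × (Fin g → F)) = (m, 0) + (0, k) := by simp
  have h2 : ((0, k + k₀ m) : (Fin n → F) × (Fin g → F)) = (0, k) + (0, k₀ m) := by simp
  rw [Equiv.coe_addRight, h1, h2, map_add, map_add, Pi.add_apply, Pi.add_apply, hk₀ m e he j,
    add_comm]

end BlockCode

/-- Linear admissible codes with `w e` symbols on the edge `e` and a key of length `g`, when no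
wiretap set carries more than `g` symbols and one carries exactly `g`. -/
theorem exists_blockCode_admissible {h : ℕ} {𝒜 : Finset (Finset (Fin h))}
    (hq : 𝒜.card ≤ Fintype.card F) {w : Fin h → ℕ} {n g : ℕ} (hn : n + g = ∑ e, w e)
    (hle : ∀ I ∈ 𝒜, ∑ e ∈ I, w e ≤ g) {I₀ : Finset (Fin h)} (hI₀ : I₀ ∈ 𝒜)
    (htight : ∑ e ∈ I₀, w e = g) :
    ∃ T : (Fin n → F) × (Fin g → F) →ₗ[F] ((e : Fin h) × Fin (w e) → F),
      (blockCode w T).Admissible 𝒜 := by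
  classical
  set S : 𝒜 → Finset ((e : Fin h) × Fin (w e)) := fun I => I.1.sigma fun _ => Finset.univ
    with hS
  have hScard : ∀ I, (S I).card = ∑ e ∈ I.1, w e := fun I => by simp [hS, Finset.card_sigma]
  obtain ⟨v, hv⟩ := exists_linearIndepOn (F := F) (by simpa using hq) (g := g) S
    fun I => (hScard I).trans_le (hle I.1 I.2)
  have hsurj : ∀ I, Function.Surjective
      (Matrix.of fun i : (S I : Set ((e : Fin h) × Fin (w e))) => v i).mulVecLin :=
    fun I => surjective_of_linearIndependent (hv I)
  set L := (Matrix.of v).mulVecLin with hL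
  -- On the tight set `I₀` the key map is a surjection between spaces of equal dimension `g`, so the
  -- key is already determined by those coordinates.
  have hLinj : Function.Injective L := by
    have hinj := (LinearMap.injective_iff_surjective_of_finrank_eq_finrank (by
      rw [Module.finrank_fin_fun, Module.finrank_fintype_fun_eq_card]
      simp [hScard, htight])).2 (hsurj ⟨I₀, hI₀⟩)
    exact fun k k' hkk => hinj (funext fun i => congrFun hkk i.1)
  obtain ⟨B, hB⟩ := exists_injective_add L hLinj (n := n) (by
    rw [Module.finrank_fin_fun, Module.finrank_fintype_fun_eq_card, hn]
    simp [Fintype.card_sigma])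
  refine ⟨B.coprod L, decodable_blockCode hB, fun I hI => condEntropy_blockCode I fun m => ?_⟩
  -- Surjectivity of the key map onto the coordinates visible on `I` provides the key that imitates
  -- `m`.
  obtain ⟨k, hk⟩ := hsurj ⟨I, hI⟩ fun i => B m i.1
  refine ⟨k, fun e he j => ?_⟩
  have := congrFun hk ⟨⟨e, j⟩, by simp [hS, he]⟩
  simp only [LinearMap.coprod_apply, map_zero, zero_add, add_zero]
  exact this

end LinearCode

/-! ### Clearing denominators -/

section Integrality

variable {h : ℕ}

theorem denomLcm_pos (y : Fin h → ℚ) : 0 < denomLcm y :=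
  Nat.pos_of_ne_zero fun h0 => by
    obtain ⟨e, -, he⟩ := Finset.lcm_eq_zero_iff.1 h0
    exact (y e).den_nz he

theorem exists_nat_eq_denomLcm_mul {y : Fin h → ℚ} (hy : ∀ e, 0 ≤ y e) (e : Fin h) :
    ∃ w : ℕ, (w : ℚ) = denomLcm y * y e := by
  obtain ⟨c, hc⟩ : (y e).den ∣ denomLcm y := Finset.dvd_lcm (Finset.mem_univ e)
  refine ⟨c * (y e).num.toNat, ?_⟩
  have hnum : (((y e).num.toNat : ℕ) : ℚ) = (y e).num := by
    exact_mod_cast Int.toNat_of_nonneg (Rat.num_nonneg.2 (hy e))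
  rw [hc, Nat.cast_mul, hnum, Nat.cast_mul]
  conv_rhs => rw [mul_comm ((y e).den : ℚ), mul_assoc, Rat.den_mul_eq_num]

end Integrality

end WiretapP2P

/-! ### Assembly of the converse and the construction -/

open WiretapP2P in
theorem mainTheorem4 (h : ℕ) (hh : 0 < h) (𝒜 : Finset (Finset (Fin h)))
    (hcov : ∀ e : Fin h, ∃ I ∈ 𝒜, e ∈ I) :
    -- an optimal rational basic solution of the dual program exists
    (∃ y : Fin h → ℚ, WiretapP2P.RationalOptimalBasic 𝒜 y) ∧
    ∀ y : Fin h → ℚ, WiretapP2P.RationalOptimalBasic 𝒜 y →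
      -- its value is the optimal value of the covering program
      IsLeast {v : ℝ | ∃ x : 𝒜 → ℝ, WiretapP2P.CoveringFeasible 𝒜 x ∧ v = ∑ I, x I}
        (∑ e, (y e : ℝ)) ∧
      -- the lower bound on the key size, for arbitrary admissible codes
      (∀ (Msg Key Alph : Type*) [Fintype Msg] [Fintype Key] [Nonempty Key] [Fintype Alph]
        (c : WiretapP2P.Code h Msg Key Alph), c.Admissible 𝒜 →
          c.entropyMsg ≤ ((∑ e, (y e : ℝ)) - 1) * c.entropyKey) ∧
      -- a linear admissible code that attains it
      ∃ (w : Fin h → ℕ) (n : ℕ),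
        (∀ e, (w e : ℚ) = WiretapP2P.denomLcm y * y e) ∧
        n + WiretapP2P.denomLcm y = ∑ e, w e ∧
        ∀ (F : Type*) [Field F] [Fintype F], 𝒜.card ≤ Fintype.card F →
          ∃ c : WiretapP2P.Code h (Fin n → F) (Fin (WiretapP2P.denomLcm y) → F)
              (Fin (Finset.univ.sup w) → F),
            c.IsLinear F ∧ c.UniformMsg ∧ c.Admissible 𝒜 ∧
            -- edge `e` carries only `w e` symbols, padded with zeros
            (∀ e x (j : Fin (Finset.univ.sup w)), w e ≤ j → c.enc e x j = 0) ∧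
            c.entropyMsg = n * Real.log (Fintype.card F) ∧
            c.entropyKey = WiretapP2P.denomLcm y * Real.log (Fintype.card F) ∧
            0 < c.entropyKey ∧
            c.entropyMsg / c.entropyKey = (∑ e, (y e : ℝ)) - 1 := by
  refine ⟨exists_rationalOptimalBasic hcov, fun y hy => ?_⟩
  have hopt := hy.1
  have hfeas := dualFeasible_iff.1 hopt.1
  have hleast := isLeast_covering hh hopt
  refine ⟨hleast, fun Msg Key Alph _ _ _ _ c hc => ?_, ?_⟩
  · obtain ⟨x, hx, hxy⟩ := exists_coveringFeasible hh hopt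
    rw [← hxy]
    exact Code.entropyMsg_le hc hx (hxy ▸ one_le_sum_of_dualOptimal hh hopt)
  choose w hw using exists_nat_eq_denomLcm_mul (y := y) fun e => by exact_mod_cast hfeas.2 e
  set g := denomLcm y with hg
  have hg0 : 0 < g := denomLcm_pos y
  have hgR : (0 : ℝ) < g := by exact_mod_cast hg0
  have hwR : ∀ e, (w e : ℝ) = g * (y e : ℝ) := fun e => by exact_mod_cast hw e
  have hsum : ∀ A : Finset (Fin h), ((∑ e ∈ A, w e : ℕ) : ℝ) = g * ∑ e ∈ A, (y e : ℝ) :=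
    fun A => by rw [Nat.cast_sum, Finset.mul_sum]; exact Finset.sum_congr rfl fun e _ => hwR e
  have hle : ∀ I ∈ 𝒜, ∑ e ∈ I, w e ≤ g := fun I hI => by
    have : ((∑ e ∈ I, w e : ℕ) : ℝ) ≤ g := by
      rw [hsum]
      exact mul_le_of_le_one_right hgR.le (hfeas.1 ⟨I, hI⟩)
    exact_mod_cast this
  obtain ⟨I₀, hI₀⟩ := exists_tight hh hopt
  have htight : ∑ e ∈ I₀.1, w e = g := by
    have : ((∑ e ∈ I₀.1, w e : ℕ) : ℝ) = g := by rw [hsum, hI₀, mul_one]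
    exact_mod_cast this
  -- The tight set alone carries `g` symbols, so the message length `n` is a genuine natural number
  -- difference.
  have hgle : g ≤ ∑ e, w e := htight ▸ Finset.sum_le_sum_of_subset (Finset.subset_univ _)
  obtain ⟨n, hn⟩ : ∃ n, n + g = ∑ e, w e := ⟨_, Nat.sub_add_cancel hgle⟩
  refine ⟨w, n, hw, hn, fun F _ _ hq => ?_⟩
  obtain ⟨T, hT⟩ := exists_blockCode_admissible hq hn hle I₀.2 htight
  have hunif : (blockCode w T).UniformMsg := fun _ => rfl
  have hlog : 0 < Real.log (Fintype.card F) :=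
    Real.log_pos (by exact_mod_cast Fintype.one_lt_card)
  have hM : (blockCode w T).entropyMsg = n * Real.log (Fintype.card F) := by
    rw [Code.entropyMsg_eq hunif, Fintype.card_fun, Fintype.card_fin, Nat.cast_pow, Real.log_pow]
  have hK : (blockCode w T).entropyKey = g * Real.log (Fintype.card F) := by
    rw [Code.entropyKey_eq, Fintype.card_fun, Fintype.card_fin, Nat.cast_pow, Real.log_pow]
  refine ⟨blockCode w T, isLinear_blockCode, hunif, hT, fun e x j hj => dif_neg hj.not_gt,
    hM, hK, hK ▸ mul_pos hgR hlog, ?_⟩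
  have hnR : (n : ℝ) + g = g * ∑ e, (y e : ℝ) := by
    rw [← hsum]
    exact_mod_cast hn
  rw [hM, hK, mul_div_mul_right _ _ hlog.ne', div_eq_iff hgR.ne']
  linarith
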